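/- Let $W:\mathcal X\to\mathcal Z$ be a discrete memoryless channel from Alice to Bob with finite alphabets. Alice and Bob may use $W$ $n$ times and, in between, exchange noiseless messages in both directions in a fixed number $r$ of rounds (in each round Alice sends a message $U_j$ and Bob answers with $V_j$). All actions of an honest party are functions of what it has received so far and of its own private discrete randomness, $M$ for Alice and $N$ for Bob, $M$ and $N$ being independent; $Z^n$ denotes the channel outputs. *Commitment.* In a commitment protocol for a finite nonempty message set $\mathcal A$, the actions of Alice in the commit phase depend in addition on a message $a\in\mathcal A$. To reveal, she announces $a$ and $M$, and Bob accepts or rejects according to a test $\beta(Z^n,N,U^r;a,M)$. The protocol is $\epsilon$-concealing if, whatever Bob does in the commit phase, the distributions of his data $Z^nNU^r$ after it, for any two messages $a,a'$, have total variation distance at most $\epsilon$. It is $\delta$-binding if for every $a$ the test accepts with probability at least $1-\delta$ when both parties are honest, and if, whatever Alice does in the commit phase, governed by a random variable $S$, and for any two openings $(A,\widetilde M)$ and $(A',\widetilde M')$ that are functions of $(S,V^r)$ with $A\neq A'$ almost surely, the test accepts both with probability at most $\delta$. A rate $R$ is achievable for commitment if for every $n$ there is a protocol with $n$ uses of $W$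 such that $\frac1n\log_2|\mathcal A|\to R$, the protocols are $\epsilon_n$-concealing and $\delta_n$-binding with $\epsilon_n,\delta_n\to0$, and the range of $U^r$ in the commit phase has at most $2^{Bn}$ elements, with a constant $B$. The commitment capacity $C_{\rm com}(W)$ is the supremum of the rates achievable for commitment. *Coin tossing.* In a coin tossing protocol for a finite nonempty set $\mathcal C$, each party outputs at the end an element of $\mathcal C$ or "reject", as a function of its own data. The protocol is $\epsilon$-secure if (i) when both are honest, the joint distribution of the two outputs is within total variation distance $\epsilon$ of that of $(c,c)$ with $c$ uniform on $\mathcal C$; (ii) whatever one party does, for every $E\subseteq\mathcal C$ the probability that the other, honest, party outputs an element of $E$ is at most $|E|/|\mathcal C|+\epsilon$. A rate $R$ is achievable for coin tossing if for every $n$ there is an $\epsilon_n$-secure protocol with $n$ uses of $W$ such that $\epsilon_n\to0$ and $\frac1n\log_2|\mathcal C|\to R$. The coin tossing capacity $C_{\rm c.t.}(W)$ is the supremum of the rates achievable for coin tossing. Then every rate $R$ with $0\le R<C_{\rm com}(W)$ is achievable for coin tossing, and hence $$C_{\rm c.t.}(W)\ \ge\ C_{\rm com}(W).$$ -/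

import Mathlib

/-! ### Discrete probability -/

/-- Probability of an event under a discrete distribution, as a real number. -/
noncomputable def pmfProb {Ω : Type*} (p : PMF Ω) (E : Set Ω) : ℝ :=
  (p.toOuterMeasure E).toReal

/-- Total variation distance `½ ‖p - q‖₁` of two discrete distributions. -/
noncomputable def tvDist {Ω : Type*} (p q : PMF Ω) : ℝ :=
  (1 / 2) * ∑' ω, |(p ω).toReal - (q ω).toReal|

/-! ### Interaction over a noiseless two-way channel and a noisy channel from Alice to Bob -/

/-- The elementary steps of an interaction: a noiseless round (Alice sends a message, then Bob
answers), or one use of the noisy channel (Alice inputs a symbol, Bob receives the output).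
A list of steps with `r` rounds and `n` uses is the same as a choice of numbers
`r₁ ≤ … ≤ rₙ ≤ r`, where `rᵢ` is the number of rounds that precede the `i`-th use. -/
inductive Step where
  | round : Step
  | use : Step
  deriving DecidableEq

/-- A deterministic behaviour of Alice: her next noiseless message as a function of Bob's messages
so far, and her input to the `i`-th use of the noisy channel (counted from `0`) as a function of
Bob's messages so far. -/
structure AliceStrategy (X U V : Type*) where
  message : List V → U
  input : ℕ → List V → X

/-- A deterministic behaviour of Bob: his answer, as a function of the channel outputs received so
far and of Alice's noiseless messages so far (including the one he answers to). -/
structure BobStrategy (Z U V : Type*) where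
  reply : List Z → List U → V

/-- A conversation: Alice's messages, Bob's messages, and the outputs of the noisy channel,
each in chronological order. -/
structure Conversation (Z U V : Type*) where
  us : List U
  vs : List V
  zs : List Z

/-- Continue the conversation `s` along a list of steps. The only randomness is that of the
channel `W`, whose uses are independent given the inputs. -/
noncomputable def continueRun {X Z U V : Type*} (W : X → PMF Z)
    (α : AliceStrategy X U V) (β : BobStrategy Z U V) :
    List Step → Conversation Z U V → PMF (Conversation Z U V)
  | [], s => PMF.pure s
  | Step.round :: l, s =>
      continueRun W α β l
        { us := s.us ++ [α.message s.vs]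
          vs := s.vs ++ [β.reply s.zs (s.us ++ [α.message s.vs])]
          zs := s.zs }
  | Step.use :: l, s =>
      (W (α.input s.zs.length s.vs)).bind fun z =>
        continueRun W α β l { us := s.us, vs := s.vs, zs := s.zs ++ [z] }

/-- The joint distribution of Alice's randomness, Bob's randomness (independent of each other) and
the resulting conversation, when Alice and Bob behave according to `α` and `β`. -/
noncomputable def runDist {X Z U V M N : Type*} (W : X → PMF Z) (l : List Step)
    (pM : PMF M) (α : M → AliceStrategy X U V) (pN : PMF N) (β : N → BobStrategy Z U V) :
    PMF (M × N × Conversation Z U V) :=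
  pM.bind fun m => pN.bind fun ν =>
    (continueRun W (α m) (β ν) l ⟨[], [], []⟩).map fun s => (m, ν, s)

/-! ### Commitment -/

/-- A commitment protocol with `n` uses of a channel with input alphabet `X` and output alphabet
`Z`, for a finite set `A` of messages. `alice a m` is Alice's behaviour in the commit phase for the
message `a` and the value `m` of her randomness, `bob ν` that of Bob for the value `ν` of his
randomness. In the reveal phase Alice announces `a` and `m`, and Bob accepts if and only if
`test zs ν us a m` holds, where `zs` are the channel outputs and `us` Alice's messages in the
commit phase. -/
structure CommitProtocol (X Z : Type*) (n : ℕ) where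
  A : Type
  fintypeA : Fintype A
  nonemptyA : Nonempty A
  U : Type
  V : Type
  M : Type
  N : Type
  schedule : List Step
  uses : schedule.count Step.use = n
  distM : PMF M
  distN : PMF N
  alice : A → M → AliceStrategy X U V
  bob : N → BobStrategy Z U V
  test : List Z → N → List U → A → M → Prop

namespace CommitProtocol

variable {X Z : Type*} {n : ℕ}

/-- The rate `(1/n) log₂ |A|`. -/
noncomputable def rate (P : CommitProtocol X Z n) : ℝ :=
  letI := P.fintypeA
  Real.logb 2 (Fintype.card P.A) / n

/-- The possible sequences of noiseless messages of honest Alice in the commit phase, over all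
`a`, all values of her randomness and all sequences of answers of Bob. -/
def messageRange (P : CommitProtocol X Z n) : Set (List P.U) :=
  {us | ∃ (a : P.A) (m : P.M) (vs : List P.V), vs.length = P.schedule.count Step.round ∧
    us = (List.range vs.length).map fun j => (P.alice a m).message (vs.take j)}

/-- The range of Alice's noiseless messages in the commit phase has at most `2 ^ (B n)`
elements. -/
def BoundedMessages (P : CommitProtocol X Z n) (B : ℝ) : Prop :=
  P.messageRange.Finite ∧ (P.messageRange.ncard : ℝ) ≤ (2 : ℝ) ^ (B * n)

/-- The distribution of Bob's data (channel outputs, own randomness, Alice's messages) after the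
commit phase, when Alice is honest with message `a`, and Bob behaves in the way `bob'`,
with own randomness. -/
noncomputable def bobView (P : CommitProtocol X Z n) (W : X → PMF Z) {N' : Type}
    (distN' : PMF N') (bob' : N' → BobStrategy Z P.U P.V) (a : P.A) :
    PMF (List Z × N' × List P.U) :=
  (runDist W P.schedule P.distM (P.alice a) distN' bob').map
    fun ω => (ω.2.2.zs, ω.2.1, ω.2.2.us)

/-- `ε`-concealing: whatever Bob does in the commit phase, his data after it have almost the same
distribution for any two messages. -/
def Concealing (P : CommitProtocol X Z n) (W : X → PMF Z) (ε : ℝ) : Prop :=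
  ∀ (N' : Type) (distN' : PMF N') (bob' : N' → BobStrategy Z P.U P.V) (a a' : P.A),
    tvDist (P.bobView W distN' bob' a) (P.bobView W distN' bob' a') ≤ ε

/-- `δ`-sound: if both follow the protocol, Bob accepts with probability at least `1 - δ`. -/
def Sound (P : CommitProtocol X Z n) (W : X → PMF Z) (δ : ℝ) : Prop :=
  ∀ a : P.A,
    1 - δ ≤ pmfProb (runDist W P.schedule P.distM (P.alice a) P.distN P.bob)
      {ω | P.test ω.2.2.zs ω.2.1 ω.2.2.us a ω.1}

/-- The second half of the binding condition: whatever Alice does in the commit phase, governed by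
a random variable `S`, with Bob honest, and for any two openings that are functions of
`S` and of Bob's messages and that announce different elements of `A` with probability `1`,
Bob's test accepts both with probability at most `δ`. -/
def BindingAgainstCheating (P : CommitProtocol X Z n) (W : X → PMF Z) (δ : ℝ) : Prop :=
  ∀ (S : Type) (distS : PMF S) (alice' : S → AliceStrategy X P.U P.V)
    (a a' : S → List P.V → P.A) (μ μ' : S → List P.V → P.M),
    (∀ ω ∈ (runDist W P.schedule distS alice' P.distN P.bob).support,
      a ω.1 ω.2.2.vs ≠ a' ω.1 ω.2.2.vs) →
    pmfProb (runDist W P.schedule distS alice' P.distN P.bob)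
      {ω | P.test ω.2.2.zs ω.2.1 ω.2.2.us (a ω.1 ω.2.2.vs) (μ ω.1 ω.2.2.vs) ∧
        P.test ω.2.2.zs ω.2.1 ω.2.2.us (a' ω.1 ω.2.2.vs) (μ' ω.1 ω.2.2.vs)} ≤ δ

/-- `δ`-binding, short for `δ`-sound and -binding. -/
def Binding (P : CommitProtocol X Z n) (W : X → PMF Z) (δ : ℝ) : Prop :=
  P.Sound W δ ∧ P.BindingAgainstCheating W δ

end CommitProtocol

/-- `R` is an achievable commitment rate of `W`. -/
def CommitAchievable {X Z : Type*} (W : X → PMF Z) (R : ℝ) : Prop :=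
  ∃ (B : ℝ) (ε δ : ℕ → ℝ) (P : ∀ n : ℕ, CommitProtocol X Z n),
    (∀ n, (P n).BoundedMessages B ∧ (P n).Concealing W (ε n) ∧ (P n).Binding W (δ n)) ∧
    Filter.Tendsto ε Filter.atTop (nhds 0) ∧
    Filter.Tendsto δ Filter.atTop (nhds 0) ∧
    Filter.Tendsto (fun n => (P n).rate) Filter.atTop (nhds R)

/-- The commitment capacity of `W`: the supremum of the achievable commitment rates. -/
noncomputable def commitCapacity {X Z : Type*} (W : X → PMF Z) : EReal :=
  sSup {r : EReal | ∃ R : ℝ, CommitAchievable W R ∧ r = (R : EReal)}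

/-! ### Coin tossing -/

/-- A coin tossing protocol with `n` uses of a channel with input alphabet `X` and output alphabet
`Z`, for a finite set `C` of coin values. After the interaction each party outputs an element of
`C`, or `none`, which means that this party rejects (having detected a violation of the rules). -/
structure CoinProtocol (X Z : Type*) (n : ℕ) where
  C : Type
  fintypeC : Fintype C
  nonemptyC : Nonempty C
  U : Type
  V : Type
  M : Type
  N : Type
  schedule : List Step
  uses : schedule.count Step.use = n
  distM : PMF M
  distN : PMF N
  alice : M → AliceStrategy X U V
  bob : N → BobStrategy Z U V
  outputA : M → List V → Option C
  outputB : List Z → N → List U → Option C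

namespace CoinProtocol

variable {X Z : Type*} {n : ℕ}

/-- The rate `(1/n) log₂ |C|`. -/
noncomputable def rate (P : CoinProtocol X Z n) : ℝ :=
  letI := P.fintypeC
  Real.logb 2 (Fintype.card P.C) / n

/-- The joint distribution of the two outputs when both parties are honest. -/
noncomputable def honestOutput (P : CoinProtocol X Z n) (W : X → PMF Z) :
    PMF (Option P.C × Option P.C) :=
  (runDist W P.schedule P.distM P.alice P.distN P.bob).map
    fun ω => (P.outputA ω.1 ω.2.2.vs, P.outputB ω.2.2.zs ω.2.1 ω.2.2.us)

/-- The ideal joint output: the same, uniformly distributed, coin value for both parties. -/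
noncomputable def idealOutput (P : CoinProtocol X Z n) : PMF (Option P.C × Option P.C) :=
  letI := P.fintypeC
  letI := P.nonemptyC
  (PMF.uniformOfFintype P.C).map fun c => (some c, some c)

/-- `ε`-correct: if both parties are honest, then up to `ε` in total variation they both output
the same uniformly distributed coin value. -/
def Correct (P : CoinProtocol X Z n) (W : X → PMF Z) (ε : ℝ) : Prop :=
  tvDist (P.honestOutput W) P.idealOutput ≤ ε

/-- `ε`-secure against Alice: whatever she does, the probability that honest Bob outputs a coin
value in a given set `E` exceeds `|E| / |C|` by at most `ε`. -/
def SecureAgainstAlice (P : CoinProtocol X Z n) (W : X → PMF Z) (ε : ℝ) : Prop :=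
  letI := P.fintypeC
  ∀ (S : Type) (distS : PMF S) (alice' : S → AliceStrategy X P.U P.V) (E : Finset P.C),
    pmfProb (runDist W P.schedule distS alice' P.distN P.bob)
      {ω | ∃ c ∈ E, P.outputB ω.2.2.zs ω.2.1 ω.2.2.us = some c}
      ≤ (E.card : ℝ) / Fintype.card P.C + ε

/-- `ε`-secure against Bob: whatever he does, the probability that honest Alice outputs a coin
value in a given set `E` exceeds `|E| / |C|` by at most `ε`. -/
def SecureAgainstBob (P : CoinProtocol X Z n) (W : X → PMF Z) (ε : ℝ) : Prop :=
  letI := P.fintypeC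
  ∀ (S : Type) (distS : PMF S) (bob' : S → BobStrategy Z P.U P.V) (E : Finset P.C),
    pmfProb (runDist W P.schedule P.distM P.alice distS bob')
      {ω | ∃ c ∈ E, P.outputA ω.1 ω.2.2.vs = some c}
      ≤ (E.card : ℝ) / Fintype.card P.C + ε

/-- `ε`-secure coin tossing. -/
def Secure (P : CoinProtocol X Z n) (W : X → PMF Z) (ε : ℝ) : Prop :=
  P.Correct W ε ∧ P.SecureAgainstAlice W ε ∧ P.SecureAgainstBob W ε

end CoinProtocol

/-- `R` is an achievable coin tossing rate of `W`. -/
def CoinAchievable {X Z : Type*} (W : X → PMF Z) (R : ℝ) : Prop :=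
  ∃ (ε : ℕ → ℝ) (P : ∀ n : ℕ, CoinProtocol X Z n),
    (∀ n, (P n).Secure W (ε n)) ∧
    Filter.Tendsto ε Filter.atTop (nhds 0) ∧
    Filter.Tendsto (fun n => (P n).rate) Filter.atTop (nhds R)

/-- The coin tossing capacity of `W`: the supremum of the achievable coin tossing rates. -/
noncomputable def coinCapacity {X Z : Type*} (W : X → PMF Z) : EReal :=
  sSup {r : EReal | ∃ R : ℝ, CoinAchievable W R ∧ r = (R : EReal)}

/-! Alice commits to a uniform element c of a finite abelian group C embedded in the message set,
Bob announces a uniform b, Alice opens, and the coin is c + b (`toCoin`). With honest parties c + b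
is uniform, and an output differs from it only if Bob's test rejects.

A cheating Bob chooses b from a view whose law moves by at most ε when c is replaced by a fixed
element. For a view independent of c, each outcome leaves at most |E| values of c with c + b in E.

A cheating Alice may let her opening depend on b. But the commit phase does not involve b, so the
openings for all b live on one probability space. Let X count the b whose opening is accepted and
gives a coin in E. Among ordered pairs of such b, those with equal opened values number at most |E|
X; those with different values have expected number at most |C|² δ by binding. Hence (𝔼X)² ≤ |E| 𝔼X
+ |C|² δ, and 𝔼X / |C| ≤ |E| / |C| + √δ (`sum_pmfProb_le_of_rarely_both`).

Taking |C| = min(⌈2^(Rn)⌉, |A|) reaches every nonnegative rate R up to an achievable commitment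
rate. -/

/-! ### Probabilities of events -/

theorem pmfProb_nonneg {Ω : Type*} (p : PMF Ω) (E : Set Ω) : 0 ≤ pmfProb p E :=
  ENNReal.toReal_nonneg

theorem PMF.toOuterMeasure_le_one {Ω : Type*} (p : PMF Ω) (E : Set Ω) :
    p.toOuterMeasure E ≤ 1 := by
  rw [PMF.toOuterMeasure_apply, ← p.tsum_coe]
  exact ENNReal.tsum_le_tsum fun ω => Set.indicator_le_self _ _ _

theorem PMF.toOuterMeasure_ne_top {Ω : Type*} (p : PMF Ω) (E : Set Ω) :
    p.toOuterMeasure E ≠ ⊤ :=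
  ((p.toOuterMeasure_le_one E).trans_lt ENNReal.one_lt_top).ne

theorem pmfProb_le_one {Ω : Type*} (p : PMF Ω) (E : Set Ω) : pmfProb p E ≤ 1 :=
  ENNReal.toReal_le_of_le_ofReal zero_le_one (by simpa using p.toOuterMeasure_le_one E)

theorem pmfProb_mono {Ω : Type*} (p : PMF Ω) {E F : Set Ω} (h : E ⊆ F) :
    pmfProb p E ≤ pmfProb p F :=
  ENNReal.toReal_mono (p.toOuterMeasure_ne_top F) (p.toOuterMeasure.mono h)

theorem pmfProb_map {Ω Ω' : Type*} (p : PMF Ω) (f : Ω → Ω') (E : Set Ω') :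
    pmfProb (p.map f) E = pmfProb p (f ⁻¹' E) := by
  rw [pmfProb, PMF.toOuterMeasure_map_apply, pmfProb]

theorem pmfProb_uniform_bind {C Ω : Type*} [Fintype C] [Nonempty C] (f : C → PMF Ω)
    (E : Set Ω) :
    pmfProb ((PMF.uniformOfFintype C).bind f) E
      = (∑ c, pmfProb (f c) E) / Fintype.card C := by
  rw [pmfProb, PMF.toOuterMeasure_bind_apply, tsum_fintype, ENNReal.toReal_sum, Finset.sum_div]
  · refine Finset.sum_congr rfl fun c _ => ?_
    simp [pmfProb, ENNReal.toReal_mul, div_eq_inv_mul]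
  · intro c _
    exact ENNReal.mul_ne_top (PMF.apply_ne_top _ _) (PMF.toOuterMeasure_ne_top _ _)

/-- Probabilities as integrals of indicators, for the discrete σ-algebra. -/
theorem pmfProb_eq_integral {Ω : Type*} (p : PMF Ω) (E : Set Ω) :
    pmfProb p E = ∫ ω, E.indicator (fun _ => (1 : ℝ)) ω ∂(@PMF.toMeasure Ω ⊤ p) := by
  let _ : MeasurableSpace Ω := ⊤
  rw [MeasureTheory.integral_indicator MeasurableSpace.measurableSet_top]
  simp [pmfProb, MeasureTheory.measureReal_def,
    PMF.toMeasure_apply_eq_toOuterMeasure_apply p (MeasurableSpace.measurableSet_top)]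

theorem pmfProb_compl {Ω : Type*} (p : PMF Ω) (E : Set Ω) :
    pmfProb p Eᶜ = 1 - pmfProb p E := by
  let _ : MeasurableSpace Ω := ⊤
  have h : ∀ E : Set Ω, pmfProb p E = p.toMeasure.real E := fun E => by
    rw [pmfProb, MeasureTheory.measureReal_def,
      PMF.toMeasure_apply_eq_toOuterMeasure_apply p MeasurableSpace.measurableSet_top]
  rw [h, h, MeasureTheory.probReal_compl_eq_one_sub MeasurableSpace.measurableSet_top]

theorem pmfProb_eq_map_mem {Ω : Type*} (p : PMF Ω) (E : Set Ω) :
    pmfProb p E = pmfProb (p.map (· ∈ E)) {q | q} := by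
  rw [pmfProb_map]
  rfl

theorem integrable_indicator_toMeasure {Ω : Type*} (p : PMF Ω) (E : Set Ω) :
    MeasureTheory.Integrable (E.indicator fun _ => (1 : ℝ)) (@PMF.toMeasure Ω ⊤ p) := by
  let _ : MeasurableSpace Ω := ⊤
  exact (MeasureTheory.integrable_const 1).indicator MeasurableSpace.measurableSet_top

/-! ### Counting and second moment bounds -/

theorem sum_indicator_le_card {Ω B B' : Type*} [Fintype B] (T : B → Set Ω) (ω : Ω) (E : Finset B')
    (f : B → B') (hf : Function.Injective f) (h : ∀ b, ω ∈ T b → f b ∈ E) :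
    ∑ b, (T b).indicator (fun _ => (1 : ℝ)) ω ≤ E.card := by
  classical
  simp only [Set.indicator_apply, Finset.sum_boole, Nat.cast_le]
  exact Finset.card_le_card_of_injOn f (fun b hb => h b (by simpa using hb)) hf.injOn

/-- If every outcome lies in at most `k` of the events, their probabilities sum to at most `k`. -/
theorem sum_pmfProb_le {Ω B : Type*} [Fintype B] (p : PMF Ω) (T : B → Set Ω) (k : ℝ)
    (h : ∀ ω, ∑ b, (T b).indicator (fun _ => (1 : ℝ)) ω ≤ k) :
    ∑ b, pmfProb p (T b) ≤ k := by
  let _ : MeasurableSpace Ω := ⊤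
  simp_rw [pmfProb_eq_integral]
  rw [← MeasureTheory.integral_finsetSum _ fun b _ => integrable_indicator_toMeasure p (T b)]
  calc _ ≤ ∫ _, k ∂p.toMeasure := MeasureTheory.integral_mono
        (MeasureTheory.integrable_finsetSum _ fun b _ => integrable_indicator_toMeasure p (T b))
        (MeasureTheory.integrable_const k) h
    _ = k := by simp

/-- A second moment bound: if events carry labels such that in each outcome at most `k` of the
occurring events share a label, and two events with different labels rarely occur together, then
the average probability of the events is at most `k / |B| + √δ`. -/
theorem sum_pmfProb_le_of_rarely_both {Ω B A : Type*} [Fintype B] [Nonempty B]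
    (p : PMF Ω) (T : B → Set Ω) (a : B → Ω → A) (k δ : ℝ) (hk : 0 ≤ k)
    (hcount : ∀ b ω, ∑ b', ({ω | ω ∈ T b' ∧ a b ω = a b' ω}).indicator (fun _ => (1 : ℝ)) ω ≤ k)
    (hδ : ∀ b b', pmfProb p {ω | ω ∈ T b ∧ ω ∈ T b' ∧ a b ω ≠ a b' ω} ≤ δ) :
    (∑ b, pmfProb p (T b)) / Fintype.card B ≤ k / Fintype.card B + √δ := by
  let _ : MeasurableSpace Ω := ⊤
  set K : ℝ := (Fintype.card B : ℝ) with hK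
  have hKpos : 0 < K := by simp [hK, Fintype.card_pos]
  have hδ0 : 0 ≤ δ := by
    obtain ⟨b⟩ := ‹Nonempty B›
    exact (pmfProb_nonneg _ _).trans (hδ b b)
  set x := ∑ b, pmfProb p (T b) with hx
  have hx0 : 0 ≤ x := Finset.sum_nonneg fun b _ => pmfProb_nonneg _ _
  let X : Ω → ℝ := fun ω => ∑ b, (T b).indicator (fun _ => (1 : ℝ)) ω
  let Y : Ω → ℝ := fun ω => ∑ b, ∑ b',
    ({ω | ω ∈ T b ∧ ω ∈ T b' ∧ a b ω ≠ a b' ω}).indicator (fun _ => (1 : ℝ)) ω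
  have hXint : MeasureTheory.Integrable X p.toMeasure :=
    MeasureTheory.integrable_finsetSum _ fun b _ => integrable_indicator_toMeasure p (T b)
  have hYint : MeasureTheory.Integrable Y p.toMeasure :=
    MeasureTheory.integrable_finsetSum _ fun b _ => MeasureTheory.integrable_finsetSum _ fun b' _ =>
      integrable_indicator_toMeasure p _
  have hX : ∫ ω, X ω ∂p.toMeasure = x := by
    rw [MeasureTheory.integral_finsetSum _ fun b _ => integrable_indicator_toMeasure p (T b), hx]
    simp_rw [pmfProb_eq_integral]
  have hY : ∫ ω, Y ω ∂p.toMeasure ≤ K * (K * δ) := by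
    rw [MeasureTheory.integral_finsetSum _ fun b _ => MeasureTheory.integrable_finsetSum _
      fun b' _ => integrable_indicator_toMeasure p _]
    calc _ ≤ ∑ _b : B, K * δ := Finset.sum_le_sum fun b _ => by
          rw [MeasureTheory.integral_finsetSum _ fun b' _ => integrable_indicator_toMeasure p _]
          calc _ ≤ ∑ _b' : B, δ := Finset.sum_le_sum fun b' _ => by
                rw [← pmfProb_eq_integral]; exact hδ b b'
            _ = K * δ := by simp [hK]
      _ = K * (K * δ) := by simp [hK]
  -- X² counts ordered pairs of occurring events: pairs with equal labels are bounded by `hcount`,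
  -- the others are counted by Y.
  have hXY : ∀ ω, X ω * X ω ≤ k * X ω + Y ω := by
    intro ω
    simp only [X, Y]
    rw [Finset.sum_mul, Finset.mul_sum, ← Finset.sum_add_distrib]
    refine Finset.sum_le_sum fun b _ => ?_
    by_cases hb : ω ∈ T b
    · have h1 := hcount b ω
      simp only [Set.indicator_of_mem hb, one_mul, mul_one]
      refine le_trans ?_ (add_le_add_left h1 _)
      rw [← Finset.sum_add_distrib]
      refine Finset.sum_le_sum fun b' _ => ?_
      by_cases hb' : ω ∈ T b' <;> by_cases hab : a b ω = a b' ω <;>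
        simp [hb, hb', hab]
    · simp only [Set.indicator_of_notMem hb, zero_mul, mul_zero, zero_add]
      exact Finset.sum_nonneg fun b' _ => Set.indicator_nonneg (fun _ _ => zero_le_one) _
  -- The tangent X² ≥ 2xX - x² at the mean makes the bound linear in X, so that only the mean of X
  -- enters.
  have hlin : ∀ ω, (2 * x - k) * X ω - x ^ 2 ≤ Y ω := fun ω => by
    nlinarith [hXY ω, sq_nonneg (X ω - x)]
  have hmain : (2 * x - k) * x - x ^ 2 ≤ K * (K * δ) := by
    have h := MeasureTheory.integral_mono
      ((hXint.const_mul (2 * x - k)).sub (MeasureTheory.integrable_const (x ^ 2))) hYint hlin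
    simp only [Pi.sub_apply] at h
    rw [MeasureTheory.integral_sub (hXint.const_mul _) (MeasureTheory.integrable_const _),
      MeasureTheory.integral_const_mul, hX] at h
    simpa using h.trans hY
  rw [div_add' _ _ _ hKpos.ne']
  refine div_le_div_of_nonneg_right ?_ hKpos.le
  -- With s = √δ K, `hmain` says x² ≤ kx + s², while x > k + s would give x(x - k) > xs ≥ s².
  by_contra! hlt
  have hs := Real.sq_sqrt hδ0
  have hs0 := Real.sqrt_nonneg δ
  have hp : 0 ≤ √δ * K := by positivity
  have hq : K * (K * δ) = (√δ * K) ^ 2 := by rw [mul_pow, hs]; ring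
  have hxpos : 0 < x := by linarith
  nlinarith [mul_nonneg hp hk, mul_pos (sub_pos.2 hlt) hxpos,
    mul_nonneg hp (sub_pos.2 hlt).le]

/-! ### Total variation distance -/

theorem summable_pmf_toReal {Ω : Type*} (p : PMF Ω) : Summable fun ω => (p ω).toReal :=
  ENNReal.summable_toReal p.tsum_coe_ne_top

theorem tsum_pmf_toReal {Ω : Type*} (p : PMF Ω) : ∑' ω, (p ω).toReal = 1 := by
  rw [← ENNReal.tsum_toReal_eq fun ω => p.apply_ne_top ω, p.tsum_coe, ENNReal.toReal_one]

theorem pmfProb_eq_tsum {Ω : Type*} (p : PMF Ω) (E : Set Ω) :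
    pmfProb p E = ∑' ω, E.indicator (fun ω => (p ω).toReal) ω := by
  rw [pmfProb, PMF.toOuterMeasure_apply, ENNReal.tsum_toReal_eq]
  · refine tsum_congr fun ω => ?_
    by_cases h : ω ∈ E <;> simp [h]
  · intro ω
    by_cases h : ω ∈ E <;> simp [h, p.apply_ne_top]

theorem tvDist_nonneg {Ω : Type*} (p q : PMF Ω) : 0 ≤ tvDist p q :=
  mul_nonneg (by norm_num) (tsum_nonneg fun _ => abs_nonneg _)

/-- Pointwise, 2·1_E (p - q) - (p - q) equals ±(p - q), hence is at most |p - q|. In the sum the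
subtracted term vanishes, both total masses being 1. -/
theorem pmfProb_le_add_tvDist {Ω : Type*} (p q : PMF Ω) (E : Set Ω) :
    pmfProb p E ≤ pmfProb q E + tvDist p q := by
  have hp := summable_pmf_toReal p
  have hq := summable_pmf_toReal q
  have habs : Summable fun ω => |(p ω).toReal - (q ω).toReal| := (hp.sub hq).abs
  have h : ∑' ω, (2 * E.indicator (fun ω => (p ω).toReal) ω
        - 2 * E.indicator (fun ω => (q ω).toReal) ω - ((p ω).toReal - (q ω).toReal))
      ≤ ∑' ω, |(p ω).toReal - (q ω).toReal| := by
    refine Summable.tsum_le_tsum (fun ω => ?_)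
      ((((hp.indicator E).mul_left 2).sub ((hq.indicator E).mul_left 2)).sub (hp.sub hq)) habs
    by_cases hω : ω ∈ E
    · simp only [Set.indicator_of_mem hω]
      linarith [le_abs_self ((p ω).toReal - (q ω).toReal)]
    · simp only [Set.indicator_of_notMem hω]
      linarith [neg_abs_le ((p ω).toReal - (q ω).toReal)]
  rw [(((hp.indicator E).mul_left 2).sub ((hq.indicator E).mul_left 2)).tsum_sub (hp.sub hq),
    ((hp.indicator E).mul_left 2).tsum_sub ((hq.indicator E).mul_left 2), tsum_mul_left,
    tsum_mul_left, hp.tsum_sub hq, tsum_pmf_toReal, tsum_pmf_toReal, ← pmfProb_eq_tsum,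
    ← pmfProb_eq_tsum] at h
  rw [tvDist]
  linarith

theorem toReal_map_apply {Ω γ : Type*} (p : PMF Ω) (F : Ω → γ) (c : γ) :
    (p.map F c).toReal = pmfProb p (F ⁻¹' {c}) := by
  rw [← pmfProb_map, pmfProb, PMF.toOuterMeasure_apply_singleton]

/-- Two random variables that differ with small probability have close distributions. -/
theorem tvDist_map_le {Ω γ : Type*} [Finite γ] (p : PMF Ω) (F G : Ω → γ) :
    tvDist (p.map F) (p.map G) ≤ pmfProb p {ω | F ω ≠ G ω} := by
  classical
  have := Fintype.ofFinite γ
  let _ : MeasurableSpace Ω := ⊤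
  have hint := fun E : Set Ω => integrable_indicator_toMeasure p E
  have h : ∀ c, |(p.map F c).toReal - (p.map G c).toReal|
      ≤ ∫ ω, (({ω | F ω ≠ G ω ∧ F ω = c}).indicator (fun _ => (1 : ℝ)) ω
        + ({ω | F ω ≠ G ω ∧ G ω = c}).indicator (fun _ => (1 : ℝ)) ω) ∂p.toMeasure := by
    intro c
    rw [toReal_map_apply, toReal_map_apply, pmfProb_eq_integral, pmfProb_eq_integral,
      ← MeasureTheory.integral_sub (hint _) (hint _)]
    refine (MeasureTheory.abs_integral_le_integral_abs).trans
      (MeasureTheory.integral_mono ((hint _).sub (hint _)).abs ((hint _).add (hint _)) fun ω => ?_)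
    by_cases h1 : F ω = c <;> by_cases h2 : G ω = c <;>
      simp [h1, h2, Ne.symm]
  rw [tvDist, tsum_fintype]
  have hs := Finset.sum_le_sum fun c (_ : c ∈ Finset.univ) => h c
  rw [← MeasureTheory.integral_finsetSum (f := fun c ω => _ + _) _
    fun c _ => (hint _).add (hint _)] at hs
  -- An outcome with F ≠ G is counted twice, at c = F ω and at c = G ω, which cancels the factor ½.
  have he : ∀ ω, ∑ c, (({ω | F ω ≠ G ω ∧ F ω = c}).indicator (fun _ => (1 : ℝ)) ω
      + ({ω | F ω ≠ G ω ∧ G ω = c}).indicator (fun _ => (1 : ℝ)) ω)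
      = 2 * ({ω | F ω ≠ G ω}).indicator (fun _ => (1 : ℝ)) ω := by
    intro ω
    by_cases h : F ω = G ω <;> simp [Set.indicator_apply, h, Finset.sum_add_distrib]
    norm_num
  simp_rw [he] at hs
  rw [MeasureTheory.integral_const_mul, ← pmfProb_eq_integral] at hs
  linarith

theorem PMF.map_add_left_uniform {C : Type*} [Fintype C] [Nonempty C] [AddGroup C] (a : C) :
    (PMF.uniformOfFintype C).map (fun b => a + b) = PMF.uniformOfFintype C := by
  classical
  ext c
  rw [PMF.map_apply, tsum_eq_single (-a + c)]
  · simp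
  · intro b hb
    rw [if_neg]
    rintro rfl
    simp at hb

/-! ### Simulation of one interaction by another -/

section

variable {X Z : Type*}

/-- The conversation after one noiseless round. -/
def Conversation.afterRound {U V : Type*} (α : AliceStrategy X U V) (β : BobStrategy Z U V)
    (s : Conversation Z U V) : Conversation Z U V where
  us := s.us ++ [α.message s.vs]
  vs := s.vs ++ [β.reply s.zs (s.us ++ [α.message s.vs])]
  zs := s.zs

theorem continueRun_round {U V : Type*} (W : X → PMF Z) (α : AliceStrategy X U V)
    (β : BobStrategy Z U V) (l : List Step) (s : Conversation Z U V) :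
    continueRun W α β (Step.round :: l) s = continueRun W α β l (s.afterRound α β) := rfl

theorem continueRun_append {U V : Type*} (W : X → PMF Z) (α : AliceStrategy X U V)
    (β : BobStrategy Z U V) (l l' : List Step) (s : Conversation Z U V) :
    continueRun W α β (l ++ l') s = (continueRun W α β l s).bind (continueRun W α β l') := by
  induction l generalizing s with
  | nil => simp [continueRun]
  | cons x l ih => cases x <;> simp [continueRun, ih]

/-- If the projection `π` carries each step of an interaction to a step of another one, as long as
the invariant `I` holds (indexed by the number of rounds left), then any functional of the final
conversation that factors through `π` can be computed in the second interaction. -/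
theorem continueRun_bind_of_simulation {U V U' V' γ : Type*} (W : X → PMF Z)
    (α : AliceStrategy X U V) (β : BobStrategy Z U V)
    (α' : AliceStrategy X U' V') (β' : BobStrategy Z U' V')
    (I : ℕ → Conversation Z U' V' → Prop) (π : Conversation Z U' V' → Conversation Z U V)
    (hround : ∀ k s, I (k + 1) s →
      I k (s.afterRound α' β') ∧ π (s.afterRound α' β') = (π s).afterRound α β)
    (huse : ∀ k s, I k s → W (α'.input s.zs.length s.vs) = W (α.input (π s).zs.length (π s).vs) ∧
      ∀ z, I k { s with zs := s.zs ++ [z] } ∧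
        π { s with zs := s.zs ++ [z] } = { π s with zs := (π s).zs ++ [z] })
    (F' : Conversation Z U' V' → PMF γ) (F : Conversation Z U V → PMF γ)
    (hF : ∀ s, I 0 s → F' s = F (π s)) (l : List Step) (s : Conversation Z U' V')
    (hs : I (l.count Step.round) s) :
    (continueRun W α' β' l s).bind F' = (continueRun W α β l (π s)).bind F := by
  induction l generalizing s with
  | nil => simpa [continueRun] using hF s hs
  | cons x l ih =>
    cases x with
    | round =>
      rw [List.count_cons_self] at hs
      obtain ⟨h1, h2⟩ := hround _ s hs
      rw [continueRun_round, continueRun_round, ih _ h1, h2]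
    | use =>
      rw [List.count_cons_of_ne (by decide)] at hs
      obtain ⟨h1, h2⟩ := huse _ s hs
      simp only [continueRun, PMF.bind_bind]
      rw [h1]
      congr 1
      funext z
      rw [← (h2 z).2, ← ih _ (h2 z).1]

theorem runDist_map {U V M N γ : Type*} (W : X → PMF Z) (l : List Step)
    (pM : PMF M) (α : M → AliceStrategy X U V) (pN : PMF N) (β : N → BobStrategy Z U V)
    (F : M × N × Conversation Z U V → γ) :
    (runDist W l pM α pN β).map F = pM.bind fun m => pN.bind fun ν =>
      (continueRun W (α m) (β ν) l ⟨[], [], []⟩).bind fun s => PMF.pure (F (m, ν, s)) := by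
  simp only [runDist, PMF.map_bind, PMF.map_comp]
  rfl

/-! ### The coin tossing protocol -/

namespace CommitProtocol

variable {n : ℕ} (P : CommitProtocol X Z n)

theorem nonempty_V : Nonempty P.V := by
  obtain ⟨ν, -⟩ := P.distN.support_nonempty
  exact ⟨(P.bob ν).reply [] []⟩

theorem nonempty_M : Nonempty P.M := ⟨P.distM.support_nonempty.choose⟩

theorem nonempty_U : Nonempty P.U := by
  obtain ⟨m⟩ := P.nonempty_M
  obtain ⟨a⟩ := P.nonemptyA
  exact ⟨(P.alice a m).message []⟩

/-- The number of rounds of the commit phase. -/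
def rounds : ℕ := P.schedule.count Step.round

/-- An arbitrary message of Alice. -/
noncomputable def defaultU : P.U := P.nonempty_U.some

/-- An arbitrary message of Bob. -/
noncomputable def defaultV : P.V := P.nonempty_V.some

/-- An arbitrary value of Alice's randomness. -/
noncomputable def defaultM : P.M := P.nonempty_M.some

variable {C : Type} [AddCommGroup C]

/-- Alice in the coin tossing protocol: she commits to `e c`, and opens the commitment in the
second round after the commit phase. -/
noncomputable def coinAlice (e : C → P.A) (c : C) (m : P.M) :
    AliceStrategy X (P.U × C × P.M) (P.V × C) where
  message vs :=
    if vs.length < P.rounds then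
      ((P.alice (e c) m).message (vs.map Prod.fst), 0, P.defaultM)
    -- Alice speaks first in each round, so Bob's announcement costs a round with a dummy message,
    -- and the opening comes one round later.
    else if vs.length = P.rounds then (P.defaultU, 0, P.defaultM)
    else (P.defaultU, c, m)
  input i vs := (P.alice (e c) m).input i (vs.map Prod.fst)

/-- Bob in the coin tossing protocol: he follows the commit phase, and announces `c` in the first
round after it. -/
noncomputable def coinBob (c : C) (ν : P.N) : BobStrategy Z (P.U × C × P.M) (P.V × C) where
  reply zs us :=
    -- Here `us` includes the message being answered, hence ≤ where Alice's test has <.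
    if us.length ≤ P.rounds then ((P.bob ν).reply zs (us.map Prod.fst), 0)
    else (P.defaultV, c)

/-- Bob's output in the coin tossing protocol, if Alice opens `(c, m)`. -/
noncomputable def coinVerdict (e : C → P.A) (b : C) (ν : P.N) (zs : List Z) (us : List P.U)
    (o : C × P.M) : Option C :=
  open Classical in if P.test zs ν us (e o.1) o.2 then some (o.1 + b) else none

/-- Coin tossing from commitment: Alice commits to a uniformly distributed element of a group,
Bob announces another one, Alice opens, and the coin is the sum. -/
noncomputable def toCoin [Fintype C] (e : C → P.A) : CoinProtocol X Z n where
  C := C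
  fintypeC := inferInstance
  nonemptyC := inferInstance
  U := P.U × C × P.M
  V := P.V × C
  M := C × P.M
  N := C × P.N
  schedule := P.schedule ++ [Step.round, Step.round]
  uses := by
    have h := P.uses
    rw [List.count_append, h]
    rfl
  distM := (PMF.uniformOfFintype C).bind fun c => P.distM.map fun m => (c, m)
  distN := (PMF.uniformOfFintype C).bind fun c => P.distN.map fun ν => (c, ν)
  alice x := P.coinAlice e x.1 x.2
  bob y := P.coinBob y.1 y.2
  outputA x vs := (vs[P.rounds]?).map fun v => x.1 + v.2
  outputB zs y us := (us[P.rounds + 1]?).bind fun u =>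
    P.coinVerdict e y.1 y.2 zs ((us.take P.rounds).map Prod.fst) u.2

/-- Forget what does not belong to the commit phase. -/
def projCommit (s : Conversation Z (P.U × C × P.M) (P.V × C)) : Conversation Z P.U P.V where
  us := s.us.map Prod.fst
  vs := s.vs.map Prod.fst
  zs := s.zs

/-- Alice's behaviour in the commit phase that corresponds to a behaviour in coin tossing. -/
def restrictAlice (α : AliceStrategy X (P.U × C × P.M) (P.V × C)) :
    AliceStrategy X P.U P.V where
  -- Honest Bob pads his commit phase answers with 0, so padding recovers the full messages.
  message vs := (α.message (vs.map fun v => (v, 0))).1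
  input i vs := α.input i (vs.map fun v => (v, 0))

/-- Alice's opening after the commit phase, if Bob announces `b`. -/
noncomputable def opening (α : AliceStrategy X (P.U × C × P.M) (P.V × C)) (vs : List P.V)
    (b : C) : C × P.M :=
  (α.message (vs.map (fun v => (v, 0)) ++ [(P.defaultV, b)])).2

/-- Bob's behaviour in the commit phase that corresponds to a behaviour in coin tossing. -/
noncomputable def restrictBob (β : BobStrategy Z (P.U × C × P.M) (P.V × C)) :
    BobStrategy Z P.U P.V where
  reply zs us := (β.reply zs (us.map fun u => (u, 0, P.defaultM))).1

/-- The element of `C` that Bob announces after the commit phase. -/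
noncomputable def announced (β : BobStrategy Z (P.U × C × P.M) (P.V × C)) (zs : List Z)
    (us : List P.U) : C :=
  (β.reply zs (us.map (fun u => (u, 0, P.defaultM)) ++ [(P.defaultU, 0, P.defaultM)])).2

/-! ### Reduction of coin tossing runs to the commit phase -/

/-- Bob's padding carries no information, so the commit phase has the same law for every b, and only
the last message depends on b. This makes the openings for different b comparable in one run. -/
theorem continueRun_cheating_alice {γ : Type*} (W : X → PMF Z)
    (α : AliceStrategy X (P.U × C × P.M) (P.V × C)) (b : C) (ν : P.N)
    (g : List Z → List (P.U × C × P.M) → γ) (F : Conversation Z P.U P.V → γ)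
    (hF : ∀ (us : List (P.U × C × P.M)) (vs : List P.V) (zs : List Z) (x y : P.U × C × P.M),
      us.length = P.rounds → y.2 = P.opening α vs b →
      g zs (us ++ [x] ++ [y]) = F ⟨us.map Prod.fst, vs, zs⟩) :
    ((continueRun W α (P.coinBob b ν) (P.schedule ++ [Step.round, Step.round])
        ⟨[], [], []⟩).bind fun s => PMF.pure (g s.zs s.us))
      = (continueRun W (P.restrictAlice α) (P.bob ν) P.schedule ⟨[], [], []⟩).bind
          fun s => PMF.pure (F s) := by
  rw [continueRun_append, PMF.bind_bind]
  refine continueRun_bind_of_simulation W _ _ α (P.coinBob b ν)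
    -- The count of remaining rounds keeps Bob in his commit phase branch; the second clause says
    -- that his messages are padded by 0.
    (fun k s => s.us.length + k = P.rounds ∧
      s.vs = (s.vs.map Prod.fst).map fun v => (v, 0)) P.projCommit ?_ ?_ _ _ ?_ _ _ ?_
  · rintro k ⟨us, vs, zs⟩ ⟨h1, h2⟩
    dsimp only at h1 h2
    have h3 : us.length + 1 ≤ P.rounds := by omega
    refine ⟨⟨?_, ?_⟩, ?_⟩
    · simp only [Conversation.afterRound, List.length_append, List.length_singleton]
      omega
    · simp only [Conversation.afterRound, List.map_append, ← h2]
      simp [coinBob, h3]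
    · simp only [Conversation.afterRound, projCommit, restrictAlice, ← h2]
      simp [coinBob, h3]
  · rintro k ⟨us, vs, zs⟩ ⟨h1, h2⟩
    dsimp only at h1 h2
    refine ⟨?_, fun z => ⟨⟨h1, h2⟩, rfl⟩⟩
    simp only [projCommit, restrictAlice, ← h2]
  · rintro ⟨us, vs, zs⟩ ⟨h1, h2⟩
    dsimp only at h1 h2
    rw [Nat.add_zero] at h1
    simp only [continueRun, PMF.pure_bind]
    congr 1
    refine hF us (vs.map Prod.fst) zs _ _ h1 ?_
    simp only [opening, ← h2]
    simp [coinBob, h1]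
  · exact ⟨by simp [rounds], rfl⟩

/-- Bob announces before the opening is sent, so his announcement is a function of his view after
the commit phase. -/
theorem continueRun_cheating_bob {γ : Type*} (W : X → PMF Z) (e : C → P.A) (c : C) (m : P.M)
    (β : BobStrategy Z (P.U × C × P.M) (P.V × C))
    (g : List (P.V × C) → γ) (F : Conversation Z P.U P.V → γ)
    (hF : ∀ (us : List P.U) (vs : List (P.V × C)) (zs : List Z) (x y : P.V × C),
      vs.length = P.rounds → x.2 = P.announced β zs us →
      g (vs ++ [x] ++ [y]) = F ⟨us, vs.map Prod.fst, zs⟩) :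
    ((continueRun W (P.coinAlice e c m) β (P.schedule ++ [Step.round, Step.round])
        ⟨[], [], []⟩).bind fun s => PMF.pure (g s.vs))
      = (continueRun W (P.alice (e c) m) (P.restrictBob β) P.schedule ⟨[], [], []⟩).bind
          fun s => PMF.pure (F s) := by
  rw [continueRun_append, PMF.bind_bind]
  refine continueRun_bind_of_simulation W _ _ (P.coinAlice e c m) β
    (fun k s => s.vs.length + k = P.rounds ∧
      s.us = (s.us.map Prod.fst).map fun u => (u, 0, P.defaultM)) P.projCommit ?_ ?_ _ _ ?_ _ _ ?_
  · rintro k ⟨us, vs, zs⟩ ⟨h1, h2⟩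
    dsimp only at h1 h2
    have h3 : vs.length < P.rounds := by omega
    refine ⟨⟨?_, ?_⟩, ?_⟩
    · simp only [Conversation.afterRound, List.length_append, List.length_singleton]
      omega
    · simp only [Conversation.afterRound, List.map_append, ← h2]
      simp [coinAlice, h3]
    · simp only [Conversation.afterRound, projCommit, restrictBob, List.map_append, ← h2]
      simp [coinAlice, h3]
  · rintro k ⟨us, vs, zs⟩ ⟨h1, h2⟩
    exact ⟨rfl, fun z => ⟨⟨h1, h2⟩, rfl⟩⟩
  · rintro ⟨us, vs, zs⟩ ⟨h1, h2⟩
    dsimp only at h1 h2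
    rw [Nat.add_zero] at h1
    simp only [continueRun, PMF.pure_bind]
    congr 1
    refine hF (us.map Prod.fst) vs zs _ _ h1 ?_
    simp only [announced, ← h2]
    simp [coinAlice, h1]
  · exact ⟨by simp [rounds], rfl⟩

/-- In the commit phase honest parties use only first components of messages, so the invariant need
only track lengths. -/
theorem continueRun_honest {γ : Type*} (W : X → PMF Z) (e : C → P.A) (c : C) (m : P.M)
    (b : C) (ν : P.N)
    (g : Conversation Z (P.U × C × P.M) (P.V × C) → γ) (F : Conversation Z P.U P.V → γ)
    (hF : ∀ (us : List (P.U × C × P.M)) (vs : List (P.V × C)) (zs : List Z) (u : P.U × C × P.M)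
      (v : P.V × C), us.length = P.rounds → vs.length = P.rounds →
      g ⟨us ++ [u] ++ [(P.defaultU, c, m)], vs ++ [(P.defaultV, b)] ++ [v], zs⟩
        = F ⟨us.map Prod.fst, vs.map Prod.fst, zs⟩) :
    ((continueRun W (P.coinAlice e c m) (P.coinBob b ν)
        (P.schedule ++ [Step.round, Step.round]) ⟨[], [], []⟩).bind fun s => PMF.pure (g s))
      = (continueRun W (P.alice (e c) m) (P.bob ν) P.schedule ⟨[], [], []⟩).bind
          fun s => PMF.pure (F s) := by
  rw [continueRun_append, PMF.bind_bind]
  refine continueRun_bind_of_simulation W _ _ (P.coinAlice e c m) (P.coinBob b ν)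
    (fun k s => s.us.length + k = P.rounds ∧ s.vs.length + k = P.rounds)
    P.projCommit ?_ ?_ _ _ ?_ _ _ ?_
  · rintro k ⟨us, vs, zs⟩ ⟨h1, h2⟩
    dsimp only at h1 h2
    have h3 : us.length + 1 ≤ P.rounds := by omega
    have h4 : vs.length < P.rounds := by omega
    refine ⟨⟨?_, ?_⟩, ?_⟩
    · simp only [Conversation.afterRound, List.length_append, List.length_singleton]
      omega
    · simp only [Conversation.afterRound, List.length_append, List.length_singleton]
      omega
    · simp [Conversation.afterRound, projCommit, coinAlice, coinBob, h3, h4]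
  · rintro k ⟨us, vs, zs⟩ ⟨h1, h2⟩
    exact ⟨rfl, fun z => ⟨⟨h1, h2⟩, rfl⟩⟩
  · rintro ⟨us, vs, zs⟩ ⟨h1, h2⟩
    dsimp only at h1 h2
    rw [Nat.add_zero] at h1 h2
    simp only [continueRun, PMF.pure_bind]
    congr 1
    convert hF us vs zs _ _ h1 h2 using 3
    · simp [coinAlice, coinBob, h1, h2]
      rfl
    · simp [coinAlice, coinBob, h1, h2]
      rfl
    all_goals rfl
  · exact ⟨by simp [rounds], by simp [rounds]⟩

end CommitProtocol

/-! ### Correctness and security -/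

/-- Recording the event as a random truth value brings runs over different conversation types to
distributions on `Prop`, where they can be equated by rewriting. -/
theorem pmfProb_runDist {U V M N : Type*} (W : X → PMF Z) (l : List Step)
    (pM : PMF M) (α : M → AliceStrategy X U V) (pN : PMF N) (β : N → BobStrategy Z U V)
    (E : Set (M × N × Conversation Z U V)) :
    pmfProb (runDist W l pM α pN β) E = pmfProb (pM.bind fun m => pN.bind fun ν =>
      (continueRun W (α m) (β ν) l ⟨[], [], []⟩).bind fun s => PMF.pure ((m, ν, s) ∈ E))
        {q | q} := by
  rw [pmfProb_eq_map_mem, runDist_map]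

namespace CommitProtocol

variable {n : ℕ} (P : CommitProtocol X Z n) {C : Type} [AddCommGroup C]

theorem coinVerdict_eq_some {e : C → P.A} {b : C} {ν : P.N} {zs : List Z} {us : List P.U}
    {o : C × P.M} {c : C} :
    P.coinVerdict e b ν zs us o = some c ↔ P.test zs ν us (e o.1) o.2 ∧ o.1 + b = c := by
  classical
  simp [coinVerdict]

variable [Fintype C]

/-- For fixed c the sum c + b is uniform. This realises the ideal output on the probability space of
the honest run, as the coupling bound `tvDist_map_le` requires. -/
theorem idealOutput_toCoin (W : X → PMF Z) (e : C → P.A) :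
    (P.toCoin e).idealOutput
      = (runDist W (P.toCoin e).schedule (P.toCoin e).distM (P.toCoin e).alice
          (P.toCoin e).distN (P.toCoin e).bob).map
        fun ω => (some (ω.1.1 + ω.2.1.1), some (ω.1.1 + ω.2.1.1)) := by
  rw [runDist_map]
  simp only [toCoin, CoinProtocol.idealOutput, PMF.bind_bind, PMF.bind_map, Function.comp_def,
    PMF.bind_const]
  have h : ∀ c : C, ((PMF.uniformOfFintype C).bind fun b =>
      (PMF.pure (some (c + b), some (c + b)) : PMF (Option C × Option C)))
      = (PMF.uniformOfFintype C).map fun c => (some c, some c) := by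
    intro c
    conv_rhs => rw [← PMF.map_add_left_uniform c, PMF.map_comp]
    rfl
  simp only [h, PMF.bind_const]

theorem toCoin_correct {W : X → PMF Z} (e : C → P.A) {δ : ℝ} (h : P.Sound W δ) :
    (P.toCoin e).Correct W δ := by
  rw [CoinProtocol.Correct, CoinProtocol.honestOutput, idealOutput_toCoin P W e]
  have : Finite (P.toCoin e).C := inferInstanceAs (Finite C)
  refine (tvDist_map_le _ _ _).trans ?_
  change pmfProb (runDist W (P.schedule ++ [Step.round, Step.round])
    ((PMF.uniformOfFintype C).bind fun c => P.distM.map fun m => (c, m))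
    (fun x => P.coinAlice e x.1 x.2)
    ((PMF.uniformOfFintype C).bind fun c => P.distN.map fun ν => (c, ν))
    fun y => P.coinBob y.1 y.2)
    {ω : (C × P.M) × (C × P.N) × Conversation Z (P.U × C × P.M) (P.V × C) |
        ((ω.2.2.vs[P.rounds]?).map fun v => ω.1.1 + v.2,
          (ω.2.2.us[P.rounds + 1]?).bind fun u => P.coinVerdict e ω.2.1.1 ω.2.1.2
            ω.2.2.zs ((ω.2.2.us.take P.rounds).map Prod.fst) u.2)
        ≠ (some (ω.1.1 + ω.2.1.1), some (ω.1.1 + ω.2.1.1))} ≤ δ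
  rw [pmfProb_runDist]
  simp only [PMF.bind_bind, PMF.bind_map, Function.comp_def]
  have key : ∀ (c : C) (m : P.M) (b : C) (ν : P.N),
      ((continueRun W (P.coinAlice e c m) (P.coinBob b ν)
        (P.schedule ++ [Step.round, Step.round]) ⟨[], [], []⟩).bind fun s => PMF.pure
          ((((c, m), (b, ν), s) : (C × P.M) × (C × P.N) × _) ∈
            {ω : (C × P.M) × (C × P.N) × Conversation Z (P.U × C × P.M) (P.V × C) |
              ((ω.2.2.vs[P.rounds]?).map fun v => ω.1.1 + v.2,
                (ω.2.2.us[P.rounds + 1]?).bind fun u => P.coinVerdict e ω.2.1.1 ω.2.1.2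
                  ω.2.2.zs ((ω.2.2.us.take P.rounds).map Prod.fst) u.2)
              ≠ (some (ω.1.1 + ω.2.1.1), some (ω.1.1 + ω.2.1.1))}))
      = (continueRun W (P.alice (e c) m) (P.bob ν) P.schedule ⟨[], [], []⟩).bind
          fun s => PMF.pure (¬ P.test s.zs ν s.us (e c) m) := by
    intro c m b ν
    refine P.continueRun_honest W e c m b ν _ _ ?_
    intro us vs zs u v h1 h2
    rw [← h1]
    simp [h1.trans h2.symm, coinVerdict]
  -- Rejection does not depend on b, so its average disappears.
  simp only [key, PMF.bind_const]
  rw [pmfProb_uniform_bind]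
  rw [div_le_iff₀ (by simp [Fintype.card_pos])]
  calc _ ≤ ∑ _c : C, δ := Finset.sum_le_sum fun c _ => ?_
    _ = _ := by simp [mul_comm]
  have h1 := pmfProb_runDist W P.schedule P.distM (P.alice (e c)) P.distN P.bob
    {ω | P.test ω.2.2.zs ω.2.1 ω.2.2.us (e c) ω.1}ᶜ
  have h2 := h (e c)
  rw [pmfProb_compl] at h1
  refine le_of_eq_of_le h1.symm ?_
  linarith

theorem toCoin_secureAgainstBob {W : X → PMF Z} (e : C → P.A) {ε : ℝ} (h : P.Concealing W ε) :
    (P.toCoin e).SecureAgainstBob W ε := by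
  intro S distS bob' E
  change Finset C at E
  change S → BobStrategy Z (P.U × C × P.M) (P.V × C) at bob'
  change pmfProb (runDist W (P.schedule ++ [Step.round, Step.round])
    ((PMF.uniformOfFintype C).bind fun c => P.distM.map fun m => (c, m))
    (fun x => P.coinAlice e x.1 x.2) distS bob')
    {ω : (C × P.M) × S × Conversation Z (P.U × C × P.M) (P.V × C) |
        ∃ x ∈ E, (ω.2.2.vs[P.rounds]?).map (fun v => ω.1.1 + v.2) = some x} ≤ (E.card : ℝ) / Fintype.card C + ε
  rw [pmfProb_runDist]
  simp only [PMF.bind_bind, PMF.bind_map, Function.comp_def]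
  have key : ∀ (c : C) (m : P.M) (σ : S),
      ((continueRun W (P.coinAlice e c m) (bob' σ)
        (P.schedule ++ [Step.round, Step.round]) ⟨[], [], []⟩).bind fun s => PMF.pure
          ((((c, m), σ, s) : (C × P.M) × S × _) ∈
            {ω : (C × P.M) × S × Conversation Z (P.U × C × P.M) (P.V × C) |
              ∃ x ∈ E, (ω.2.2.vs[P.rounds]?).map (fun v => ω.1.1 + v.2) = some x}))
      = (continueRun W (P.alice (e c) m) (P.restrictBob (bob' σ)) P.schedule ⟨[], [], []⟩).bind
          fun s => PMF.pure (c + P.announced (bob' σ) s.zs s.us ∈ E) := by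
    intro c m σ
    refine P.continueRun_cheating_bob W e c m (bob' σ)
      (fun vs => ∃ x ∈ E, (vs[P.rounds]?).map (fun v => c + v.2) = some x) _ ?_
    intro us vs zs x y h1 h2
    simp [← h1, h2]
  simp only [key]
  rw [pmfProb_uniform_bind]
  have hK : (0 : ℝ) < Fintype.card C := by simp [Fintype.card_pos]
  rw [div_add' _ _ _ hK.ne']
  refine div_le_div_of_nonneg_right ?_ hK.le
  let T : C → Set (List Z × S × List P.U) := fun c =>
    {v | c + P.announced (bob' v.2.1) v.1 v.2.2 ∈ E}
  let view := P.bobView W distS fun σ => P.restrictBob (bob' σ)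
  have h1 : ∀ c, pmfProb (P.distM.bind fun m => distS.bind fun σ =>
      (continueRun W (P.alice (e c) m) (P.restrictBob (bob' σ)) P.schedule ⟨[], [], []⟩).bind
          fun s => PMF.pure (c + P.announced (bob' σ) s.zs s.us ∈ E)) {q | q}
      = pmfProb (view (e c)) (T c) := by
    intro c
    simp only [view, bobView]
    rw [pmfProb_map, pmfProb_runDist]
    rfl
  simp only [h1]
  -- Concealing replaces each commitment by one to the fixed message `e 0`; then all events `T c`
  -- are measured by one distribution and can be counted.
  calc _ ≤ ∑ c, (pmfProb (view (e 0)) (T c) + ε) := Finset.sum_le_sum fun c _ =>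
        (pmfProb_le_add_tvDist _ _ _).trans (add_le_add_right (h S distS _ (e c) (e 0)) _)
    _ ≤ E.card + ε * Fintype.card C := by
        rw [Finset.sum_add_distrib]
        refine add_le_add (sum_pmfProb_le _ _ _ fun v => ?_) (by simp [mul_comm])
        exact sum_indicator_le_card T v E (fun c => c + P.announced (bob' v.2.1) v.1 v.2.2)
          (add_left_injective _) fun c hc => hc

theorem Sound.nonneg {P : CommitProtocol X Z n} {W : X → PMF Z} {δ : ℝ} (h : P.Sound W δ) :
    0 ≤ δ := by
  obtain ⟨a⟩ := P.nonemptyA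
  linarith [(h a).trans (pmfProb_le_one _ _)]

theorem Concealing.nonneg {P : CommitProtocol X Z n} {W : X → PMF Z} {ε : ℝ}
    (h : P.Concealing W ε) : 0 ≤ ε := by
  obtain ⟨a⟩ := P.nonemptyA
  exact (tvDist_nonneg _ _).trans (h P.N P.distN P.bob a a)

/-- The binding condition for openings that may announce the same message: they are rarely both
accepted while announcing different messages. -/
theorem BindingAgainstCheating.pmfProb_ne_le {P : CommitProtocol X Z n} {W : X → PMF Z} {δ : ℝ}
    (h : P.BindingAgainstCheating W δ) (hδ : 0 ≤ δ) {S : Type} (distS : PMF S)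
    (alice' : S → AliceStrategy X P.U P.V)
    (a a' : S → List P.V → P.A) (μ μ' : S → List P.V → P.M) :
    pmfProb (runDist W P.schedule distS alice' P.distN P.bob)
      {ω | P.test ω.2.2.zs ω.2.1 ω.2.2.us (a ω.1 ω.2.2.vs) (μ ω.1 ω.2.2.vs) ∧
        P.test ω.2.2.zs ω.2.1 ω.2.2.us (a' ω.1 ω.2.2.vs) (μ' ω.1 ω.2.2.vs) ∧
        a ω.1 ω.2.2.vs ≠ a' ω.1 ω.2.2.vs} ≤ δ := by
  classical
  -- Binding demands openings that always differ. Where they agree, the second is altered, which is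
  -- harmless outside the event; with a single message the event is empty.
  rcases subsingleton_or_nontrivial P.A with hA | hA
  · have hne : ∀ x y : P.A, (x ≠ y) = False := fun x y => by simp [Subsingleton.elim x y]
    simpa only [hne, and_false, Set.ofPred_false, pmfProb, MeasureTheory.measure_empty,
      ENNReal.toReal_zero] using hδ
  · choose other hother using fun x : P.A => exists_ne x
    refine (pmfProb_mono _ ?_).trans (h S distS alice' a
      (fun s vs => if a s vs = a' s vs then other (a s vs) else a' s vs) μ μ' fun ω _ => ?_)
    · rintro ω ⟨h1, h2, h3⟩
      refine ⟨h1, ?_⟩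
      simpa [h3] using h2
    · by_cases hω : a ω.1 ω.2.2.vs = a' ω.1 ω.2.2.vs
      · simp [hω, (hother _).symm]
      · simp [hω]

/-- The second moment bound applies with the opened value as label: for a given label c, injectivity
of b ↦ c + b leaves at most |E| successful b, and binding makes success with two labels rare. -/
theorem toCoin_secureAgainstAlice {W : X → PMF Z} {e : C → P.A} (he : Function.Injective e)
    {δ : ℝ} (hδ : 0 ≤ δ) (h : P.BindingAgainstCheating W δ) :
    (P.toCoin e).SecureAgainstAlice W √δ := by
  classical
  intro S distS alice' E
  change Finset C at E
  change S → AliceStrategy X (P.U × C × P.M) (P.V × C) at alice'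
  change pmfProb (runDist W (P.schedule ++ [Step.round, Step.round]) distS alice'
    ((PMF.uniformOfFintype C).bind fun c => P.distN.map fun ν => (c, ν))
    fun y => P.coinBob y.1 y.2)
    {ω : S × (C × P.N) × Conversation Z (P.U × C × P.M) (P.V × C) |
        ∃ x ∈ E, ((ω.2.2.us[P.rounds + 1]?).bind fun u => P.coinVerdict e ω.2.1.1 ω.2.1.2
            ω.2.2.zs ((ω.2.2.us.take P.rounds).map Prod.fst) u.2) = some x} ≤ (E.card : ℝ) / Fintype.card C + √δ
  rw [pmfProb_runDist]
  simp only [PMF.bind_bind, PMF.bind_map, Function.comp_def]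
  have key : ∀ (σ : S) (b : C) (ν : P.N),
      ((continueRun W (alice' σ) (P.coinBob b ν)
        (P.schedule ++ [Step.round, Step.round]) ⟨[], [], []⟩).bind fun s => PMF.pure
          (((σ, (b, ν), s) : S × (C × P.N) × _) ∈
            {ω : S × (C × P.N) × Conversation Z (P.U × C × P.M) (P.V × C) |
              ∃ x ∈ E, ((ω.2.2.us[P.rounds + 1]?).bind fun u => P.coinVerdict e ω.2.1.1 ω.2.1.2
                  ω.2.2.zs ((ω.2.2.us.take P.rounds).map Prod.fst) u.2) = some x}))
      = (continueRun W (P.restrictAlice (alice' σ)) (P.bob ν) P.schedule ⟨[], [], []⟩).bind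
          fun s => PMF.pure (∃ x ∈ E, P.coinVerdict e b ν s.zs s.us
            (P.opening (alice' σ) s.vs b) = some x) := by
    intro σ b ν
    refine P.continueRun_cheating_alice W (alice' σ) b ν
      (fun zs us => ∃ x ∈ E, ((us[P.rounds + 1]?).bind fun u => P.coinVerdict e b ν
        zs ((us.take P.rounds).map Prod.fst) u.2) = some x) _ ?_
    intro us vs zs x y h1 h2
    simp [← h1, h2]
  simp only [key]
  -- Drawing b before Alice's randomness turns the probability into an average over b of events in
  -- the same commit phase.
  rw [PMF.bind_comm, pmfProb_uniform_bind]
  let T : C → Set (S × P.N × Conversation Z P.U P.V) := fun b =>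
    {ω | ∃ x ∈ E, P.coinVerdict e b ω.2.1 ω.2.2.zs ω.2.2.us
      (P.opening (alice' ω.1) ω.2.2.vs b) = some x}
  refine le_trans (le_of_eq ?_) (sum_pmfProb_le_of_rarely_both
    (runDist W P.schedule distS (fun σ => P.restrictAlice (alice' σ)) P.distN P.bob) T
    (fun b ω => (P.opening (alice' ω.1) ω.2.2.vs b).1) E.card δ (Nat.cast_nonneg _) ?_ ?_)
  · congr 1
    refine Finset.sum_congr rfl fun b _ => ?_
    rw [pmfProb_runDist]
    rfl
  · intro b ω
    refine sum_indicator_le_card _ ω E (fun b' => (P.opening (alice' ω.1) ω.2.2.vs b).1 + b')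
      (add_right_injective _) ?_
    rintro b' ⟨⟨x, hx, hb'⟩, h2⟩
    obtain ⟨-, rfl⟩ := P.coinVerdict_eq_some.1 hb'
    exact h2 ▸ hx
  · intro b b'
    refine (pmfProb_mono _ ?_).trans (h.pmfProb_ne_le hδ distS
      (fun σ => P.restrictAlice (alice' σ))
      (fun σ vs => e (P.opening (alice' σ) vs b).1) (fun σ vs => e (P.opening (alice' σ) vs b').1)
      (fun σ vs => (P.opening (alice' σ) vs b).2) (fun σ vs => (P.opening (alice' σ) vs b').2))
    rintro ω ⟨⟨x, -, hx⟩, ⟨x', -, hx'⟩, hne⟩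
    exact ⟨(P.coinVerdict_eq_some.1 hx).1, (P.coinVerdict_eq_some.1 hx').1, he.ne hne⟩

theorem toCoin_secure {W : X → PMF Z} {e : C → P.A} (he : Function.Injective e)
    {ε δ : ℝ} (hε : P.Concealing W ε) (hδ : P.Binding W δ) :
    (P.toCoin e).Secure W (ε + δ + √δ) := by
  have h1 := hε.nonneg
  have h2 := hδ.1.nonneg
  have h3 := Real.sqrt_nonneg δ
  refine ⟨(P.toCoin_correct e hδ.1).trans (by linarith), fun S distS alice' E => ?_,
    fun S distS bob' E => ?_⟩
  · exact (P.toCoin_secureAgainstAlice he h2 hδ.2 S distS alice' E).trans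
      (add_le_add_right (by linarith) _)
  · exact (P.toCoin_secureAgainstBob e hε S distS bob' E).trans
      (add_le_add_right (by linarith) _)

end CommitProtocol

/-! ### Rates and capacities -/

/-- Commitment protocols give coin tossing protocols of any smaller size. -/
theorem CoinAchievable.of_commit {W : X → PMF Z} {R : ℝ} {ε δ : ℕ → ℝ}
    (P : ∀ n, CommitProtocol X Z n) (hP : ∀ n, (P n).Concealing W (ε n) ∧ (P n).Binding W (δ n))
    (hε : Filter.Tendsto ε Filter.atTop (nhds 0)) (hδ : Filter.Tendsto δ Filter.atTop (nhds 0))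
    (K : ℕ → ℕ) (hK0 : ∀ n, K n ≠ 0) (hK : ∀ n, K n ≤ Nat.card (P n).A)
    (hR : Filter.Tendsto (fun n : ℕ => Real.logb 2 (K n) / n) Filter.atTop (nhds R)) :
    CoinAchievable W R := by
  have (n : ℕ) : NeZero (K n) := ⟨hK0 n⟩
  have (n : ℕ) : Fintype (P n).A := (P n).fintypeA
  have emb : ∀ n, ∃ e : ZMod (K n) → (P n).A, Function.Injective e := fun n => by
    obtain ⟨f⟩ := Function.Embedding.nonempty_of_card_le (α := ZMod (K n)) (β := (P n).A)
      (by rw [ZMod.card, ← Nat.card_eq_fintype_card]; exact hK n)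
    exact ⟨f, f.injective⟩
  choose e he using emb
  refine ⟨fun n => ε n + δ n + √(δ n), fun n => (P n).toCoin (e n),
    fun n => (P n).toCoin_secure (he n) (hP n).1 (hP n).2, ?_, ?_⟩
  · simpa using (hε.add hδ).add hδ.sqrt
  · refine hR.congr fun n => ?_
    simp [CoinProtocol.rate, CommitProtocol.toCoin, ZMod.card]

theorem CommitProtocol.rate_eq {n : ℕ} (P : CommitProtocol X Z n) :
    P.rate = Real.logb 2 (Nat.card P.A) / n := by
  let _ := P.fintypeA
  rw [CommitProtocol.rate, Nat.card_eq_fintype_card]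

theorem CommitProtocol.card_pos {n : ℕ} (P : CommitProtocol X Z n) : 0 < Nat.card P.A := by
  let _ := P.fintypeA
  have := P.nonemptyA
  exact Nat.card_pos

theorem CommitAchievable.coinAchievable {W : X → PMF Z} {R : ℝ} (h : CommitAchievable W R) :
    CoinAchievable W R := by
  obtain ⟨B, ε, δ, P, hP, hε, hδ, hR⟩ := h
  refine CoinAchievable.of_commit P (fun n => (hP n).2) hε hδ (fun n => Nat.card (P n).A)
    (fun n => (P n).card_pos.ne') (fun n => le_rfl) ?_
  simpa only [CommitProtocol.rate_eq] using hR

/-- As R ≥ 0, the ceiling lies between 2^(Rn) and 2 · 2^(Rn), so the rate lies between R and R +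
1/n. -/
theorem tendsto_logb_ceil_rpow_div {R : ℝ} (hR : 0 ≤ R) :
    Filter.Tendsto (fun n : ℕ => Real.logb 2 (⌈(2 : ℝ) ^ (R * n)⌉₊ : ℝ) / n)
      Filter.atTop (nhds R) := by
  have hlim : Filter.Tendsto (fun n : ℕ => R + 1 / (n : ℝ)) Filter.atTop (nhds R) := by
    simpa using tendsto_const_nhds.add (tendsto_one_div_atTop_nhds_zero_nat (𝕜 := ℝ))
  refine tendsto_of_tendsto_of_tendsto_of_le_of_le' tendsto_const_nhds hlim ?_ ?_
  all_goals
    filter_upwards [Filter.eventually_gt_atTop 0] with n hn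
    have hn' : (0 : ℝ) < n := by exact_mod_cast hn
    have hpos : (0 : ℝ) < 2 ^ (R * n) := by positivity
    have hone : (1 : ℝ) ≤ 2 ^ (R * n) := Real.one_le_rpow one_le_two (by positivity)
    have hle := Nat.le_ceil ((2 : ℝ) ^ (R * n))
  · rw [le_div_iff₀ hn', Real.le_logb_iff_rpow_le one_lt_two (hpos.trans_le hle)]
    exact hle
  · have hlt := Nat.ceil_lt_add_one hpos.le
    rw [div_le_iff₀ hn', Real.logb_le_iff_le_rpow one_lt_two (hpos.trans_le hle)]
    have : (R + 1 / n) * n = R * n + 1 := by field_simp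
    rw [this, Real.rpow_add two_pos, Real.rpow_one]
    linarith

theorem CommitAchievable.coinAchievable_of_le {W : X → PMF Z} {R R' : ℝ} (hR : 0 ≤ R)
    (hRR' : R ≤ R') (h : CommitAchievable W R') : CoinAchievable W R := by
  obtain ⟨B, ε, δ, P, hP, hε, hδ, hR'⟩ := h
  have hceil : ∀ n : ℕ, 0 < ⌈(2 : ℝ) ^ (R * n)⌉₊ := fun n => Nat.ceil_pos.2 (by positivity)
  refine CoinAchievable.of_commit P (fun n => (hP n).2) hε hδ
    -- The message set may be smaller than 2^(Rn) for some n; the minimum guarantees an embedding,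
    -- and the rates still tend to min(R, R') = R.
    (fun n => min ⌈(2 : ℝ) ^ (R * n)⌉₊ (Nat.card (P n).A))
    (fun n => (lt_min (hceil n) (P n).card_pos).ne') (fun n => min_le_right _ _) ?_
  have hlim := (tendsto_logb_ceil_rpow_div hR).min hR'
  rw [min_eq_left hRR'] at hlim
  refine hlim.congr fun n => ?_
  rw [CommitProtocol.rate_eq, min_div_div_right (Nat.cast_nonneg n)]
  congr 1
  have hmono := (Real.strictMonoOn_logb one_lt_two).monotoneOn
  rw [Nat.cast_min]
  exact (hmono.map_min (by simpa using hceil n) (by simpa using (P n).card_pos)).symm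

end

theorem corollary2 {X Z : Type*} [Finite X] [Nonempty X] [Finite Z] (W : X → PMF Z) :
    (∀ R : ℝ, 0 ≤ R → (R : EReal) < commitCapacity W → CoinAchievable W R) ∧
      commitCapacity W ≤ coinCapacity W := by
  refine ⟨fun R hR hlt => ?_, sSup_le ?_⟩
  · obtain ⟨_, ⟨R', hR', rfl⟩, hRR'⟩ := lt_sSup_iff.1 hlt
    exact hR'.coinAchievable_of_le hR (EReal.coe_lt_coe_iff.1 hRR').le
  · rintro _ ⟨R, hR, rfl⟩
    exact le_sSup ⟨R, hR.coinAchievable, rfl⟩
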